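/- Let $K$ be a number field that is Galois over $\mathbb{Q}$, with ring of integers $\mathcal{O}_K$; let $k$ be a positive integer; fix an embedding $K\hookrightarrow\mathbb{C}$ (the choice is immaterial) and let $|\cdot|$ be the resulting complex absolute value; and let $a\in\mathcal{O}_K$ satisfy $|\sigma(a)|\ge 2$ for all $\sigma\in\mathrm{Gal}(K/\mathbb{Q})$. A nonzero prime ideal $\mathfrak{p}$ of $\mathcal{O}_K$ with $\mathrm{Nm}(\mathfrak{p})=q$ is called a non-Wieferich place base $a$ if $v_{\mathfrak{p}}(a^{q-1}-1)=1$, where $v_{\mathfrak p}(x)$ is the exponent of $\mathfrak{p}$ in the factorization of the ideal $(x)$ (and $v_{\mathfrak p}(0)=\infty$). For $a_1,a_2,a_3\in K^\times$ put $$H(a_1,a_2,a_3)=\prod_v\max(\|a_1\|_v,\|a_2\|_v,\|a_3\|_v),\qquad N(a_1,a_2,a_3)=\prod_{\mathfrak{p}\in I}\mathrm{Nm}(\mathfrak{p})^{1/[K:\mathbb{Q}]},$$ where $v$ runs over all places of $K$, finite and infinite, $\|x\|_v=|x|_v^{[K_v:\mathbb{Q}_v]/[K:\mathbb{Q}]}$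 with $|\cdot|_v$ extending the usual absolute value $|\cdot|_w$ of $\mathbb{Q}$ at the place $w$ below $v$ (and $\mathbb{Q}_v$ denoting the completion $\mathbb{Q}_w$), and $I$ is the finite set of nonzero prime ideals $\mathfrak{p}$ for which $\|a_1\|_{\mathfrak{p}},\|a_2\|_{\mathfrak{p}},\|a_3\|_{\mathfrak{p}}$ are not all equal. Assume the $abc$ conjecture for $K$: for every $\varepsilon>0$ there is a constant $C=C(\varepsilon,K)>0$ such that $$H(\alpha,\beta,\alpha+\beta)\le C\,N(\alpha,\beta,\alpha+\beta)^{1+\varepsilon}$$ for all $\alpha,\beta\in K^\times$ with $\alpha+\beta\ne0$. Then there are constants $c>0$ and $x_0$, depending only on $K$, $a$ and $k$, such that for every real $x\ge x_0$ there are at least $c\log x$ non-Wieferich places $\mathfrak{p}$ base $a$ with $\mathrm{Nm}(\mathfrak{p})\le x$ and $\mathrm{Nm}(\mathfrak{p})\equiv 1\pmod{k}$. -/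

import Mathlib

open NumberField IsDedekindDomain

/-- The absolute height `H(a₁, a₂, a₃) = ∏_v max(‖a₁‖_v, ‖a₂‖_v, ‖a₃‖_v)` of a nonzero triple, the
product being over all (finite and infinite) places `v` of `K`, with the normalization
`‖a‖_v = |a|_v ^ ([K_v : ℚ_v] / [K : ℚ])`. -/
noncomputable def tripleHeight (K : Type*) [Field K] [NumberField K] (a₁ a₂ a₃ : K) : ℝ :=
  Height.mulHeight ![a₁, a₂, a₃] ^ (1 / (Module.finrank ℚ K : ℝ))

/-- The finite places at which the absolute values of `a₁`, `a₂`, `a₃` are not all equal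
(finitely many if `a₁`, `a₂`, `a₃` are nonzero). -/
def conductorPlaces (K : Type*) [Field K] [NumberField K] (a₁ a₂ a₃ : K) :
    Set (HeightOneSpectrum (𝓞 K)) :=
  {p | ¬ (p.valuation K a₁ = p.valuation K a₂ ∧ p.valuation K a₂ = p.valuation K a₃)}

/-- The conductor `N(a₁, a₂, a₃) = ∏_p Nm(p) ^ (1 / [K : ℚ])`, over the finite places `p` at which
the absolute values of `a₁`, `a₂`, `a₃` are not all equal. -/
noncomputable def tripleConductor (K : Type*) [Field K] [NumberField K] (a₁ a₂ a₃ : K) : ℝ :=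
  ∏ᶠ p ∈ conductorPlaces K a₁ a₂ a₃,
    (Ideal.absNorm p.asIdeal : ℝ) ^ (1 / (Module.finrank ℚ K : ℝ))

/-- The `abc` conjecture for the number field `K`. -/
def ABCConjecture (K : Type*) [Field K] [NumberField K] : Prop :=
  ∀ ε : ℝ, 0 < ε → ∃ C : ℝ, 0 < C ∧ ∀ α β : K, α ≠ 0 → β ≠ 0 → α + β ≠ 0 →
    tripleHeight K α β (α + β) ≤ C * tripleConductor K α β (α + β) ^ (1 + ε)

/-- `p` is a non-Wieferich place base `a`: the `p`-adic valuation of `a ^ (Nm(p) - 1) - 1` is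
exactly one. -/
def IsNonWieferichPlace {K : Type*} [Field K] [NumberField K] (a : 𝓞 K)
    (p : HeightOneSpectrum (𝓞 K)) : Prop :=
  emultiplicity p.asIdeal (Ideal.span {a ^ (Ideal.absNorm p.asIdeal - 1) - 1}) = 1

/-! Write d for the degree of K and A for the norm of (a), and let n = 4km. A prime p that divides
Φ_n(a) but not n makes a of exact order n mod p, so n, hence k, divides Nm(p) - 1. If also v_p(a^n -
1) = 1, then p is non-Wieferich. Such p exist because abc, applied to (a^n - 1) + 1 = a^n, bounds
the norm of the powerful part of a^n - 1 by a constant times A^(2εn)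
(`ABCConjecture.exists_powerfulNorm_le`). Without a suitable p, the norm of Φ_n(a) is at most n^d
times that bound (`absNorm_le_or_exists_isNonWieferichPlace`). But this norm is at least 3^(dφ(m)),
a contradiction when φ(m) ≥ m/8, ε is small and m is large. A positive proportion of all m satisfy
φ(m) ≥ m/8 (`le_card_filter_totient`). Different m give different p, and Nm(p) ≤ A^(8km), so the m
up to a multiple of log x give the count. -/

/-! ### Integers with large totient. -/

theorem two_mul_le_totient_add_sum_divisors {m : ℕ} (hm : 0 < m) :
    2 * m ≤ m.totient + ∑ d ∈ m.divisors, d := by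
  have h1 := Nat.sum_totient m
  have h2 : ∑ d ∈ m.properDivisors, d.totient ≤ ∑ d ∈ m.properDivisors, d :=
    Finset.sum_le_sum fun d _ => Nat.totient_le d
  rw [← Nat.cons_self_properDivisors hm.ne', Finset.sum_cons] at h1 ⊢
  omega

theorem sum_divisors_div_eq_sum_inv {m : ℕ} (hm : 0 < m) :
    (∑ d ∈ m.divisors, (d : ℝ)) / m = ∑ d ∈ m.divisors, (d : ℝ)⁻¹ := by
  rw [← Nat.sum_div_divisors m (fun d => (d : ℝ)), Finset.sum_div]
  refine Finset.sum_congr rfl fun d hd => ?_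
  have hdm := Nat.dvd_of_mem_divisors hd
  have hd0 : (d : ℝ) ≠ 0 := by
    exact_mod_cast (Nat.pos_of_mem_divisors hd).ne'
  have : (m : ℝ) ≠ 0 := by exact_mod_cast hm.ne'
  rw [Nat.cast_div hdm hd0]
  field_simp

theorem sum_inv_sq_le (M : ℕ) : ∑ d ∈ Finset.Icc 1 M, ((d : ℝ) ^ 2)⁻¹ ≤ 7 / 4 := by
  -- The term 1/M lets the induction telescope; at M = 2 there is equality.
  have key : ∀ M : ℕ, 2 ≤ M → ∑ d ∈ Finset.Icc 1 M, ((d : ℝ) ^ 2)⁻¹ ≤ 7 / 4 - (M : ℝ)⁻¹ := by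
    intro M hM
    induction M, hM using Nat.le_induction with
    | base => norm_num [Finset.sum_Icc_succ_top]
    | succ n hn ih =>
      rw [Finset.sum_Icc_succ_top (by omega)]
      have hn0 : (0 : ℝ) < n := by exact_mod_cast (by omega : 0 < n)
      have : (((n + 1 : ℕ) : ℝ) ^ 2)⁻¹ ≤ (n : ℝ)⁻¹ - ((n + 1 : ℕ) : ℝ)⁻¹ := by
        push_cast
        rw [inv_sub_inv (by positivity) (by positivity), inv_eq_one_div,
          div_le_div_iff₀ (by positivity) (by positivity)]
        nlinarith
      linarith
  rcases lt_or_ge M 2 with h | h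
  · interval_cases M <;> norm_num
  · have := key M h
    have : (0 : ℝ) ≤ (M : ℝ)⁻¹ := by positivity
    linarith

theorem sum_sum_divisors_inv_le (M : ℕ) :
    ∑ m ∈ Finset.Icc 1 M, ∑ d ∈ m.divisors, (d : ℝ)⁻¹ ≤ 7 / 4 * M := by
  have h : ∑ m ∈ Finset.Icc 1 M, ∑ d ∈ m.divisors, (d : ℝ)⁻¹ =
      ∑ d ∈ Finset.Icc 1 M, ∑ m ∈ Finset.Icc 1 M with d ∣ m, (d : ℝ)⁻¹ := by
    refine Finset.sum_comm' fun m d => ?_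
    simp only [Finset.mem_Icc, Nat.mem_divisors, Finset.mem_filter]
    constructor
    · rintro ⟨⟨h1, h2⟩, h3, h4⟩
      exact ⟨⟨⟨h1, h2⟩, h3⟩, Nat.pos_of_dvd_of_pos h3 h1, (Nat.le_of_dvd h1 h3).trans h2⟩
    · rintro ⟨⟨⟨h1, h2⟩, h3⟩, h4, h5⟩
      exact ⟨⟨h1, h2⟩, h3, by omega⟩
  rw [h]
  calc _ ≤ ∑ d ∈ Finset.Icc 1 M, ((d : ℝ) ^ 2)⁻¹ * M := by
        refine Finset.sum_le_sum fun d hd => ?_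
        have hd0 : 0 < d := (Finset.mem_Icc.mp hd).1
        have hcard : ((Finset.Icc 1 M).filter (d ∣ ·)).card = M / d := by
          have := Nat.Ioc_filter_dvd_card_eq_div M d
          rwa [show Finset.Ioc 0 M = Finset.Icc 1 M from rfl] at this
        rw [Finset.sum_const, hcard, nsmul_eq_mul]
        have : ((M / d : ℕ) : ℝ) ≤ M / d := Nat.cast_div_le
        have hd1 : (0 : ℝ) < d := by exact_mod_cast hd0
        calc ((M / d : ℕ) : ℝ) * (d : ℝ)⁻¹ ≤ (M / d) * (d : ℝ)⁻¹ := by gcongr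
          _ = _ := by field_simp
    _ ≤ 7 / 4 * M := by
        rw [← Finset.sum_mul]
        exact mul_le_mul_of_nonneg_right (sum_inv_sq_le M) (by positivity)

/-- By 2m ≤ φ(m) + σ(m), the mean of φ(m)/m is at least 2 - 7/4 = 1/4. Integers outside the set
contribute at most 1/8 each to the sum and the others at most 1. -/
theorem le_card_filter_totient (M : ℕ) :
    (M : ℝ) / 8 ≤ ((Finset.Icc 1 M).filter fun m => m ≤ 8 * m.totient).card := by
  set S := (Finset.Icc 1 M).filter fun m => m ≤ 8 * m.totient with hS
  have h1 : ∀ m ∈ Finset.Icc 1 M, (2 : ℝ) ≤ (m.totient : ℝ) / m + ∑ d ∈ m.divisors, (d : ℝ)⁻¹ := by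
    intro m hm
    have hm0 := (Finset.mem_Icc.mp hm).1
    have hm1 : (0 : ℝ) < m := by exact_mod_cast hm0
    rw [← sum_divisors_div_eq_sum_inv hm0, ← add_div, le_div_iff₀ hm1]
    have : ((2 * m : ℕ) : ℝ) ≤ ((m.totient + ∑ d ∈ m.divisors, d : ℕ) : ℝ) :=
      Nat.cast_le.mpr (two_mul_le_totient_add_sum_divisors hm0)
    push_cast at this
    exact this
  have h2 : ∀ m ∈ Finset.Icc 1 M,
      (m.totient : ℝ) / m ≤ 1 / 8 + if m ≤ 8 * m.totient then (1 : ℝ) else 0 := by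
    intro m hm
    have hm1 : (0 : ℝ) < m := by exact_mod_cast (Finset.mem_Icc.mp hm).1
    rw [div_le_iff₀ hm1]
    split_ifs with h
    · have : (m.totient : ℝ) ≤ m := by exact_mod_cast Nat.totient_le m
      linarith
    · have : (8 * m.totient : ℝ) ≤ m := by exact_mod_cast (not_le.mp h).le
      linarith
  have h3 := Finset.sum_le_sum fun m hm => (h1 m hm).trans (add_le_add_left (h2 m hm) _)
  rw [Finset.sum_add_distrib, Finset.sum_add_distrib, ← Finset.sum_filter] at h3
  simp only [Finset.sum_const, Nat.card_Icc, nsmul_eq_mul, add_tsub_cancel_right] at h3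
  have h4 := sum_sum_divisors_inv_le M
  rw [← hS] at h3
  linarith

/-! ### Sizes of cyclotomic values and norms. -/

/-- For even N, Φ_{2N}(z) = Φ_N(z²), whose factors z² - μ have modulus at least 4 - 1 = 3. The
factors z - μ would only give the bound 1, which is why the indices used later are multiples of 4.
-/
theorem three_pow_totient_le_norm_eval_cyclotomic {N : ℕ} (hN : 0 < N) (h2 : 2 ∣ N) {z : ℂ}
    (hz : 2 ≤ ‖z‖) : 3 ^ N.totient ≤ ‖(Polynomial.cyclotomic (N * 2) ℂ).eval z‖ := by
  have hζ := Complex.isPrimitiveRoot_exp N hN.ne'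
  rw [← Polynomial.cyclotomic_expand_eq_cyclotomic Nat.prime_two h2, Polynomial.expand_eval,
    Polynomial.cyclotomic_eq_prod_X_sub_primitiveRoots hζ, Polynomial.eval_prod, norm_prod,
    ← hζ.card_primitiveRoots, ← Finset.prod_const]
  refine Finset.prod_le_prod (fun _ _ => by norm_num) fun μ hμ => ?_
  have hμ1 : ‖μ‖ = 1 :=
    Complex.norm_eq_one_of_pow_eq_one ((mem_primitiveRoots hN).mp hμ).pow_eq_one hN.ne'
  have h := norm_sub_norm_le (z ^ 2) μ
  rw [norm_pow, hμ1] at h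
  simp only [Polynomial.eval_sub, Polynomial.eval_X, Polynomial.eval_C]
  nlinarith

section

variable {K : Type*} [Field K] [NumberField K]

theorem absNorm_span_singleton_eq_abs_norm (x : 𝓞 K) :
    (Ideal.absNorm (Ideal.span {x}) : ℝ) = |(Algebra.norm ℚ (x : K) : ℝ)| := by
  rw [Ideal.absNorm_span_singleton, Nat.cast_natAbs, ← Algebra.coe_norm_int x]
  push_cast
  rfl

theorem absNorm_span_singleton_eq_prod_embeddings (x : 𝓞 K) :
    (Ideal.absNorm (Ideal.span {x}) : ℝ) = ∏ φ : K →+* ℂ, ‖φ x‖ := by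
  rw [absNorm_span_singleton_eq_abs_norm]
  have h := congr_arg (‖·‖) (Algebra.norm_eq_prod_embeddings ℚ ℂ (x : K))
  simp only [norm_prod] at h
  rw [← Fintype.prod_equiv (RingHom.equivRatAlgHom K ℂ) (fun f => ‖f x‖)
      (fun φ => ‖φ x‖) fun _ => by simp [RingHom.equivRatAlgHom_apply]] at h
  rw [← h, eq_ratCast, ← Real.norm_eq_abs, ← Complex.norm_real, Complex.ofReal_ratCast]

/-- Every embedding is i composed with an automorphism; this is where K being Galois enters. -/
theorem two_le_norm_embedding [IsGalois ℚ K] (i : K →+* ℂ) {a : 𝓞 K}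
    (ha : ∀ σ : K ≃ₐ[ℚ] K, 2 ≤ ‖i (σ (a : K))‖) (φ : K →+* ℂ) : 2 ≤ ‖φ a‖ := by
  obtain ⟨σ, rfl⟩ :=
    NumberField.ComplexEmbedding.exists_comp_symm_eq_of_comp_eq (k := ℚ) i φ (by ext; simp)
  exact ha σ.symm

theorem absNorm_span_pow_sub_one_le {a : 𝓞 K} (ha : ∀ φ : K →+* ℂ, 2 ≤ ‖φ a‖) (n : ℕ) :
    (Ideal.absNorm (Ideal.span {a ^ n - 1}) : ℝ) ≤
      2 ^ Module.finrank ℚ K * (Ideal.absNorm (Ideal.span {a}) : ℝ) ^ n := by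
  rw [absNorm_span_singleton_eq_prod_embeddings, absNorm_span_singleton_eq_prod_embeddings,
    ← NumberField.Embeddings.card K ℂ, Fintype.card, ← Finset.prod_const, ← Finset.prod_pow,
    ← Finset.prod_mul_distrib]
  refine Finset.prod_le_prod (fun _ _ => norm_nonneg _) fun φ _ => ?_
  have h1 : 1 ≤ ‖φ a‖ ^ n := one_le_pow₀ (by linarith [ha φ])
  have h2 := norm_sub_le (φ (a : K) ^ n) 1
  rw [norm_pow, norm_one] at h2
  simp only [map_sub, map_pow, map_one]
  linarith

theorem two_pow_finrank_le_absNorm {a : 𝓞 K} (ha : ∀ φ : K →+* ℂ, 2 ≤ ‖φ a‖) :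
    2 ^ Module.finrank ℚ K ≤ Ideal.absNorm (Ideal.span {a}) := by
  have : (2 : ℝ) ^ Module.finrank ℚ K ≤ (Ideal.absNorm (Ideal.span {a}) : ℝ) := by
    rw [absNorm_span_singleton_eq_prod_embeddings, ← NumberField.Embeddings.card K ℂ,
      Fintype.card, ← Finset.prod_const]
    exact Finset.prod_le_prod (fun _ _ => by norm_num) fun φ _ => ha φ
  exact_mod_cast this

theorem three_pow_le_absNorm_span_eval_cyclotomic {a : 𝓞 K} (ha : ∀ φ : K →+* ℂ, 2 ≤ ‖φ a‖)
    {N : ℕ} (hN : 0 < N) (h2 : 2 ∣ N) :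
    (3 : ℝ) ^ (N.totient * Module.finrank ℚ K) ≤
      Ideal.absNorm (Ideal.span {(Polynomial.cyclotomic (N * 2) (𝓞 K)).eval a}) := by
  rw [absNorm_span_singleton_eq_prod_embeddings, ← NumberField.Embeddings.card K ℂ,
    Fintype.card, pow_mul, ← Finset.prod_const]
  refine Finset.prod_le_prod (fun _ _ => by positivity) fun φ _ => ?_
  have h : φ ((Polynomial.cyclotomic (N * 2) (𝓞 K)).eval a : 𝓞 K) =
      (Polynomial.cyclotomic (N * 2) ℂ).eval (φ a) := by
    rw [← Polynomial.map_cyclotomic (N * 2) (φ.comp (algebraMap (𝓞 K) K)), Polynomial.eval_map]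
    exact (Polynomial.eval₂_at_apply (φ.comp (algebraMap (𝓞 K) K)) a).symm
  rw [h]
  exact three_pow_totient_le_norm_eval_cyclotomic hN h2 (ha φ)

end

/-! ### Radical, powerful part and conductor. -/

section

open UniqueFactorizationMonoid

variable {K : Type*} [Field K] [NumberField K]

open scoped Classical in
/-- The product of the norms of the prime ideals dividing `I`. -/
noncomputable def radicalNorm (I : Ideal (𝓞 K)) : ℕ :=
  ∏ p ∈ (normalizedFactors I).toFinset, Ideal.absNorm p

open scoped Classical in
/-- The norm of the powerful part of `I`. -/
noncomputable def powerfulNorm (I : Ideal (𝓞 K)) : ℕ :=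
  ∏ p ∈ (normalizedFactors I).toFinset with 2 ≤ (normalizedFactors I).count p,
    Ideal.absNorm p ^ (normalizedFactors I).count p

theorem one_le_absNorm_of_mem_normalizedFactors {I p : Ideal (𝓞 K)}
    (hp : p ∈ normalizedFactors I) : 1 ≤ Ideal.absNorm p :=
  Nat.one_le_iff_ne_zero.mpr fun h =>
    (prime_of_normalized_factor p hp).ne_zero (Ideal.absNorm_eq_zero_iff.mp h)

open scoped Classical in
theorem absNorm_eq_prod_normalizedFactors {I : Ideal (𝓞 K)} (hI : I ≠ 0) :
    Ideal.absNorm I =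
      ∏ p ∈ (normalizedFactors I).toFinset, Ideal.absNorm p ^ (normalizedFactors I).count p := by
  conv_lhs => rw [← Ideal.prod_normalizedFactors_eq_self hI, Finset.prod_multiset_count, map_prod]
  simp only [map_pow]

theorem one_le_radicalNorm (I : Ideal (𝓞 K)) : 1 ≤ radicalNorm I := by
  classical
  exact Finset.one_le_prod' fun p hp =>
    one_le_absNorm_of_mem_normalizedFactors (Multiset.mem_toFinset.mp hp)

theorem radicalNorm_le_absNorm {I : Ideal (𝓞 K)} (hI : I ≠ 0) :
    radicalNorm I ≤ Ideal.absNorm I := by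
  classical
  rw [absNorm_eq_prod_normalizedFactors hI]
  refine Finset.prod_le_prod' fun p hp => ?_
  rw [Multiset.mem_toFinset] at hp
  exact Nat.le_self_pow (Multiset.count_pos.mpr hp).ne' _

/-- Prime by prime: an exponent e = 1 gives 2 ≤ 2, and e ≥ 2 gives 2 + e ≤ 2e. A lower bound for the
radical thus becomes an upper bound for the powerful part. -/
theorem radicalNorm_sq_mul_powerfulNorm_le {I : Ideal (𝓞 K)} (hI : I ≠ 0) :
    radicalNorm I ^ 2 * powerfulNorm I ≤ Ideal.absNorm I ^ 2 := by
  classical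
  rw [absNorm_eq_prod_normalizedFactors hI, radicalNorm, powerfulNorm, Finset.prod_filter,
    ← Finset.prod_pow, ← Finset.prod_pow, ← Finset.prod_mul_distrib]
  refine Finset.prod_le_prod' fun p hp => ?_
  rw [Multiset.mem_toFinset] at hp
  have h1 := one_le_absNorm_of_mem_normalizedFactors hp
  have h2 := Multiset.count_pos.mpr hp
  split_ifs with h
  · rw [← pow_add, ← pow_mul]
    exact Nat.pow_le_pow_right h1 (by omega)
  · rw [mul_one, ← pow_mul]
    exact Nat.pow_le_pow_right h1 (by omega)

open scoped Classical in
-- Primes of J with exponent one in I occur once in J, and their product divides N; the rest of J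
-- divides the powerful part of I.
theorem absNorm_le_mul_powerfulNorm {I J N : Ideal (𝓞 K)} (hI : I ≠ 0) (hN : N ≠ 0) (hJI : J ∣ I)
    (h : ∀ p : Ideal (𝓞 K), Prime p → (normalizedFactors I).count p = 1 → p ∣ J → p ∣ N) :
    Ideal.absNorm J ≤ Ideal.absNorm N * powerfulNorm I := by
  have hJ : J ≠ 0 := ne_zero_of_dvd_ne_zero hI hJI
  have hle := (dvd_iff_normalizedFactors_le_normalizedFactors hJ hI).mp hJI
  rw [absNorm_eq_prod_normalizedFactors hJ, powerfulNorm,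
    ← Finset.prod_filter_mul_prod_filter_not _
      (fun p => (normalizedFactors I).count p = 1)]
  refine Nat.mul_le_mul ?_ ?_
  · refine Nat.le_of_dvd (Nat.pos_of_ne_zero fun h0 => hN (Ideal.absNorm_eq_zero_iff.mp h0)) ?_
    have : ∀ p ∈ (normalizedFactors J).toFinset.filter
        (fun p => (normalizedFactors I).count p = 1),
        Ideal.absNorm p ^ (normalizedFactors J).count p = Ideal.absNorm p := by
      intro p hp
      rw [Finset.mem_filter, Multiset.mem_toFinset] at hp
      have h1 := Multiset.count_pos.mpr hp.1
      have h2 := Multiset.count_le_of_le p hle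
      rw [show (normalizedFactors J).count p = 1 by omega, pow_one]
    rw [Finset.prod_congr rfl this, ← map_prod]
    refine Ideal.absNorm_dvd_absNorm_of_le (Ideal.dvd_iff_le.mp ?_)
    refine Finset.prod_primes_dvd _ (fun p hp => ?_) fun p hp => ?_
    all_goals rw [Finset.mem_filter, Multiset.mem_toFinset] at hp
    · exact prime_of_normalized_factor p hp.1
    · exact h p (prime_of_normalized_factor p hp.1) hp.2 (dvd_of_mem_normalizedFactors hp.1)
  · refine (Finset.prod_le_prod' fun p hp => ?_).trans
      (Finset.prod_le_prod_of_subset_of_one_le' ?_ fun p hp _ => ?_)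
    · rw [Finset.mem_filter, Multiset.mem_toFinset] at hp
      exact Nat.pow_le_pow_right (one_le_absNorm_of_mem_normalizedFactors hp.1)
        (Multiset.count_le_of_le p hle)
    · intro p hp
      rw [Finset.mem_filter, Multiset.mem_toFinset] at hp ⊢
      have h1 := Multiset.mem_of_le hle hp.1
      have h2 := Multiset.count_pos.mpr h1
      exact ⟨h1, by omega⟩
    · rw [Finset.mem_filter, Multiset.mem_toFinset] at hp
      exact Nat.one_le_pow _ _ (one_le_absNorm_of_mem_normalizedFactors hp.1)

/-- Used with b = a^n and e = a, so that the first radical does not depend on n. -/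
theorem tripleConductor_sub_one_le {b e : 𝓞 K} (hb1 : b - 1 ≠ 0)
    (he : e ≠ 0) (hbe : ∀ p : HeightOneSpectrum (𝓞 K), b ∈ p.asIdeal → e ∈ p.asIdeal) :
    tripleConductor K ((b - 1 : 𝓞 K) : K) 1 (b : K) ≤
      ((radicalNorm (Ideal.span {e}) * radicalNorm (Ideal.span {b - 1}) : ℕ) : ℝ) ^
        (1 / (Module.finrank ℚ K : ℝ)) := by
  classical
  set s := (normalizedFactors (Ideal.span {e})).toFinset with hs
  set t := (normalizedFactors (Ideal.span {b - 1})).toFinset with ht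
  have hmem : ∀ {x : 𝓞 K}, x ≠ 0 → ∀ p : HeightOneSpectrum (𝓞 K), x ∈ p.asIdeal →
      p.asIdeal ∈ (normalizedFactors (Ideal.span {x})).toFinset := by
    intro x hx p hp
    rw [Multiset.mem_toFinset, Ideal.mem_normalizedFactors_iff (by simpa using hx)]
    exact ⟨p.isPrime, (Ideal.span_singleton_le_iff_mem _).mpr hp⟩
  have hsub : ∀ p ∈ conductorPlaces K ((b - 1 : 𝓞 K) : K) 1 (b : K), p.asIdeal ∈ s ∪ t := by
    intro p hp
    by_contra hcon
    rw [Finset.mem_union, not_or] at hcon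
    have h1 : b ∉ p.asIdeal := fun h => hcon.1 (hmem he p (hbe p h))
    have h2 : b - 1 ∉ p.asIdeal := fun h => hcon.2 (hmem hb1 p h)
    refine hp ⟨?_, ?_⟩
    · rw [map_one]
      exact p.valuation_eq_one_iff_notMem.mpr h2
    · rw [map_one]
      exact (p.valuation_eq_one_iff_notMem.mpr h1).symm
  have hinj : Function.Injective (HeightOneSpectrum.asIdeal : HeightOneSpectrum (𝓞 K) → _) :=
    fun p q h => HeightOneSpectrum.ext h
  have hfin : (conductorPlaces K ((b - 1 : 𝓞 K) : K) 1 (b : K)).Finite :=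
    ((s ∪ t).finite_toSet.preimage hinj.injOn).subset hsub
  have hone : ∀ p ∈ s ∪ t, 1 ≤ Ideal.absNorm p := by
    intro p hp
    rw [Finset.mem_union, hs, ht, Multiset.mem_toFinset, Multiset.mem_toFinset] at hp
    exact hp.elim one_le_absNorm_of_mem_normalizedFactors one_le_absNorm_of_mem_normalizedFactors
  rw [tripleConductor, finprod_mem_eq_finite_toFinset_prod _ hfin,
    Real.finsetProd_rpow _ _ (fun _ _ => by positivity)]
  refine Real.rpow_le_rpow (by positivity) ?_ (by positivity)
  rw [← Nat.cast_prod, Nat.cast_le, ← Finset.prod_image (g := HeightOneSpectrum.asIdeal)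
    (f := fun p : Ideal (𝓞 K) => Ideal.absNorm p) hinj.injOn]
  refine (Finset.prod_le_prod_of_subset_of_one_le' (t := s ∪ t) ?_
    fun p hp _ => hone p hp).trans ?_
  · intro p hp
    obtain ⟨q, hq, rfl⟩ := Finset.mem_image.mp hp
    exact hsub q (hfin.mem_toFinset.mp hq)
  · rw [radicalNorm, radicalNorm, ← Finset.prod_union_inter]
    refine Nat.le_mul_of_pos_right _ (Finset.prod_pos fun p hp => ?_)
    exact hone p (Finset.mem_union_left _ (Finset.mem_inter.mp hp).1)

end

/-! ### Consequences of abc. -/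

section

variable {K : Type*} [Field K] [NumberField K]

theorem pow_sub_one_ne_zero_of_two_le {a : 𝓞 K} (ha : ∀ φ : K →+* ℂ, 2 ≤ ‖φ a‖) {n : ℕ}
    (hn : n ≠ 0) : a ^ n - 1 ≠ 0 := by
  intro h
  obtain ⟨φ⟩ : Nonempty (K →+* ℂ) := inferInstance
  have h1 : φ (a : K) ^ n = 1 := by
    have h2 := congr_arg (fun x : 𝓞 K => φ (x : K)) (sub_eq_zero.mp h)
    simpa using h2
  have h3 := Complex.norm_eq_one_of_pow_eq_one h1 hn
  linarith [ha φ]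

/-- Dropping the coordinate c lowers the height, and the archimedean factors of the height of b
already dominate its norm. -/
theorem absNorm_le_mulHeight (b c : 𝓞 K) :
    (Ideal.absNorm (Ideal.span {b}) : ℝ) ≤ Height.mulHeight ![(c : K), 1, (b : K)] := by
  have h1 : Height.mulHeight₁ (b : K) ≤ Height.mulHeight ![(c : K), 1, (b : K)] := by
    rw [Height.mulHeight₁_eq_mulHeight]
    have h := Height.mulHeight_comp_le (![2, 1] : Fin 2 → Fin 3) ![(c : K), 1, (b : K)]
    convert h using 2
    ext j
    fin_cases j <;> rfl
  refine le_trans ?_ h1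
  rw [absNorm_span_singleton_eq_abs_norm, NumberField.mulHeight₁_eq, ← Rat.cast_abs,
    ← InfinitePlace.prod_eq_abs_norm]
  have h2 : (1 : ℝ) ≤ ∏ᶠ v : FinitePlace K, max (v (b : K)) 1 :=
    one_le_finprod fun _ => le_max_right _ _
  have h3 : ∏ v : InfinitePlace K, v (b : K) ^ v.mult ≤
      ∏ v : InfinitePlace K, max (v (b : K)) 1 ^ v.mult :=
    Finset.prod_le_prod (fun _ _ => by positivity) fun v _ =>
      pow_le_pow_left₀ (by positivity) (le_max_left _ _) _
  have h4 : (0 : ℝ) ≤ ∏ v : InfinitePlace K, max (v (b : K)) 1 ^ v.mult :=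
    Finset.prod_nonneg fun v _ => by positivity
  exact h3.trans (le_mul_of_one_le_right h4 h2)

theorem ABCConjecture.exists_absNorm_pow_le (habc : ABCConjecture K) {a : 𝓞 K}
    (ha : ∀ φ : K →+* ℂ, 2 ≤ ‖φ a‖) {ε : ℝ} (hε : 0 < ε) :
    ∃ C : ℝ, 0 < C ∧ ∀ n : ℕ, n ≠ 0 → (Ideal.absNorm (Ideal.span {a}) : ℝ) ^ n ≤
      C * ((radicalNorm (Ideal.span {a}) * radicalNorm (Ideal.span {a ^ n - 1}) : ℕ) : ℝ) ^
        (1 + ε) := by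
  obtain ⟨C, hC, h⟩ := habc ε hε
  -- Height and conductor carry the exponent 1/d, removed by taking d-th powers.
  refine ⟨C ^ Module.finrank ℚ K, by positivity, fun n hn => ?_⟩
  have hd : (0 : ℝ) < Module.finrank ℚ K := by exact_mod_cast Module.finrank_pos
  have ha0 : a ≠ 0 := by
    rintro rfl
    obtain ⟨φ⟩ : Nonempty (K →+* ℂ) := inferInstance
    have := ha φ
    norm_num at this
  have h1 : a ^ n - 1 ≠ 0 := pow_sub_one_ne_zero_of_two_le ha hn
  have hb : a ^ n ≠ 0 := pow_ne_zero n ha0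
  have hsum : ((a ^ n - 1 : 𝓞 K) : K) + 1 = ((a ^ n : 𝓞 K) : K) := by simp
  have h2 := h ((a ^ n - 1 : 𝓞 K) : K) 1 (RingOfIntegers.coe_ne_zero_iff.mpr h1) one_ne_zero
    (by rw [hsum]; exact RingOfIntegers.coe_ne_zero_iff.mpr hb)
  rw [hsum, tripleHeight] at h2
  have h3 := tripleConductor_sub_one_le h1 ha0 fun p hp => p.isPrime.mem_of_pow_mem n hp
  set R : ℝ := ((radicalNorm (Ideal.span {a}) * radicalNorm (Ideal.span {a ^ n - 1}) : ℕ) : ℝ)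
    with hR
  have hcond : 0 ≤ tripleConductor K ((a ^ n - 1 : 𝓞 K) : K) 1 ((a ^ n : 𝓞 K) : K) :=
    finprod_mem_induction (0 ≤ ·) zero_le_one (fun _ _ => mul_nonneg) fun _ _ => by positivity
  have h4 : Height.mulHeight ![((a ^ n - 1 : 𝓞 K) : K), 1, ((a ^ n : 𝓞 K) : K)] ^
      (1 / (Module.finrank ℚ K : ℝ)) ≤ C * (R ^ (1 / (Module.finrank ℚ K : ℝ))) ^ (1 + ε) :=
    h2.trans (by gcongr)
  have h5 := (absNorm_le_mulHeight (a ^ n) (a ^ n - 1)).trans_eq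
    (Real.rpow_inv_natCast_pow (Height.mulHeight_pos _).le
      (Module.finrank_pos (R := ℚ) (M := K)).ne').symm
  rw [← Ideal.span_singleton_pow, map_pow, Nat.cast_pow] at h5
  refine h5.trans ?_
  rw [← one_div]
  refine (pow_le_pow_left₀ (Real.rpow_nonneg (Height.mulHeight_pos _).le _) h4 _).trans_eq ?_
  rw [mul_pow, ← Real.rpow_natCast (_ ^ (1 + ε)), ← Real.rpow_mul (by positivity),
    ← Real.rpow_mul (by positivity)]
  congr 2
  field_simp

/-- Multiply the square of the abc bound by the bound for (rt)²Q and cancel A^(2n)(rt)²: this leaves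
Q ≤ (ADC)²(rt)^(2ε), where the trivial bound rt ≤ AD·A^n suffices. -/
theorem le_of_pow_le_of_sq_mul_le {A B C D Q r t ε : ℝ} {n : ℕ} (hA : 0 < A) (hD : 0 < D)
    (hC : 0 < C) (hε : 0 < ε) (hQ : 0 ≤ Q) (hr : 0 < r) (ht : 0 < t) (hrA : r ≤ A) (htB : t ≤ B)
    (hB : B ≤ D * A ^ n) (hQB : t ^ 2 * Q ≤ B ^ 2) (h : A ^ n ≤ C * (r * t) ^ (1 + ε)) :
    Q ≤ (A * D * C) ^ 2 * (A * D) ^ (2 * ε) * A ^ (2 * ε * n) := by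
  have hR : 0 < r * t := mul_pos hr ht
  have hB0 : 0 ≤ B := ht.le.trans htB
  have hRA : r * t ≤ A * D * A ^ n := by
    calc r * t ≤ A * (D * A ^ n) := mul_le_mul hrA (htB.trans hB) ht.le hA.le
      _ = _ := by ring
  have hRQ : (r * t) ^ 2 * Q ≤ A ^ 2 * (D * A ^ n) ^ 2 := by
    calc (r * t) ^ 2 * Q = r ^ 2 * (t ^ 2 * Q) := by ring
      _ ≤ A ^ 2 * (D * A ^ n) ^ 2 :=
        mul_le_mul (pow_le_pow_left₀ hr.le hrA 2)
          (hQB.trans (pow_le_pow_left₀ hB0 hB 2)) (by positivity) (by positivity)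
  have h2 : (A ^ n) ^ 2 * ((r * t) ^ 2 * Q) ≤
      (C * (r * t) ^ (1 + ε)) ^ 2 * (A ^ 2 * (D * A ^ n) ^ 2) :=
    mul_le_mul (pow_le_pow_left₀ (by positivity) h 2) hRQ (by positivity) (by positivity)
  have h3 : (r * t) ^ (1 + ε) = r * t * (r * t) ^ ε := by rw [Real.rpow_add hR, Real.rpow_one]
  have h4 : Q ≤ (A * D * C) ^ 2 * ((r * t) ^ ε) ^ 2 := by
    rw [h3] at h2
    have hpos : 0 < (A ^ n) ^ 2 * (r * t) ^ 2 := by positivity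
    refine le_of_mul_le_mul_left ?_ hpos
    calc _ = (A ^ n) ^ 2 * ((r * t) ^ 2 * Q) := by ring
      _ ≤ _ := h2
      _ = _ := by ring
  have h5 : ((r * t) ^ ε) ^ 2 = (r * t) ^ (2 * ε) := by
    rw [← Real.rpow_natCast, ← Real.rpow_mul hR.le]
    congr 1
    push_cast
    ring
  have h6 : (r * t) ^ (2 * ε) ≤ (A * D) ^ (2 * ε) * A ^ (2 * ε * n) := by
    refine (Real.rpow_le_rpow hR.le hRA (by positivity)).trans_eq ?_
    rw [Real.mul_rpow (by positivity) (by positivity), ← Real.rpow_natCast A n,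
      ← Real.rpow_mul hA.le, mul_comm (n : ℝ)]
  rw [h5] at h4
  rw [mul_assoc]
  exact h4.trans (mul_le_mul_of_nonneg_left h6 (by positivity))

theorem ABCConjecture.exists_powerfulNorm_le (habc : ABCConjecture K) {a : 𝓞 K}
    (ha : ∀ φ : K →+* ℂ, 2 ≤ ‖φ a‖) {ε : ℝ} (hε : 0 < ε) :
    ∃ C : ℝ, 0 < C ∧ ∀ n : ℕ, n ≠ 0 → (powerfulNorm (Ideal.span {a ^ n - 1}) : ℝ) ≤
      C * (Ideal.absNorm (Ideal.span {a}) : ℝ) ^ (2 * ε * n) := by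
  obtain ⟨C, hC, h⟩ := habc.exists_absNorm_pow_le ha hε
  set d := Module.finrank ℚ K with hd
  set A : ℝ := (Ideal.absNorm (Ideal.span {a}) : ℝ) with hA
  have hA2 : (2 : ℝ) ^ d ≤ A := by
    have := two_pow_finrank_le_absNorm ha
    rw [hA]
    exact_mod_cast this
  have hA0 : 0 < A := lt_of_lt_of_le (by positivity) hA2
  refine ⟨(A * 2 ^ d * C) ^ 2 * (A * 2 ^ d) ^ (2 * ε), by positivity, fun n hn => ?_⟩
  have hspan : ∀ {x : 𝓞 K}, x ≠ 0 → Ideal.span {x} ≠ 0 := fun hx => by simpa using hx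
  have ha0 : a ≠ 0 := by
    rintro rfl
    simp [hA] at hA0
  have hI := hspan (pow_sub_one_ne_zero_of_two_le ha hn)
  set Q : ℝ := (powerfulNorm (Ideal.span {a ^ n - 1}) : ℝ) with hQ
  set r : ℝ := (radicalNorm (Ideal.span {a}) : ℝ) with hr
  set t : ℝ := (radicalNorm (Ideal.span {a ^ n - 1}) : ℝ) with ht
  set B : ℝ := (Ideal.absNorm (Ideal.span {a ^ n - 1}) : ℝ) with hB
  have hr1 : 1 ≤ r := Nat.one_le_cast.mpr (one_le_radicalNorm _)
  have ht1 : 1 ≤ t := Nat.one_le_cast.mpr (one_le_radicalNorm _)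
  have hrA : r ≤ A := Nat.cast_le.mpr (radicalNorm_le_absNorm (hspan ha0))
  have htB : t ≤ B := Nat.cast_le.mpr (radicalNorm_le_absNorm hI)
  have hQB : t ^ 2 * Q ≤ B ^ 2 := by
    rw [hQ, ht, hB, ← Nat.cast_pow, ← Nat.cast_pow, ← Nat.cast_mul, Nat.cast_le]
    exact radicalNorm_sq_mul_powerfulNorm_le hI
  have h1 := h n hn
  rw [Nat.cast_mul, ← hr, ← ht] at h1
  exact le_of_pow_le_of_sq_mul_le hA0 (by positivity) hC hε (Nat.cast_nonneg _)
    (by linarith) (by linarith) hrA htB (absNorm_span_pow_sub_one_le ha n) hQB h1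

end

/-! ### Primitive prime divisors of a^n - 1. -/

theorem isPrimitiveRoot_mk_of_eval_cyclotomic_mem {K : Type*} [Field K] {p : Ideal (𝓞 K)} [p.IsPrime] {a : 𝓞 K} {n : ℕ}
    (hn : (n : 𝓞 K) ∉ p) (h : (Polynomial.cyclotomic n (𝓞 K)).eval a ∈ p) :
    IsPrimitiveRoot (Ideal.Quotient.mk p a) n := by
  have : NeZero ((n : ℕ) : 𝓞 K ⧸ p) :=
    ⟨fun h0 => hn (Ideal.Quotient.eq_zero_iff_mem.mp (by rw [map_natCast]; exact h0))⟩
  rw [← Polynomial.isRoot_cyclotomic_iff, Polynomial.IsRoot, ← Polynomial.map_cyclotomic n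
    (Ideal.Quotient.mk p), Polynomial.eval_map, Polynomial.eval₂_at_apply]
  exact Ideal.Quotient.eq_zero_iff_mem.mpr h

section

open UniqueFactorizationMonoid

variable {K : Type*} [Field K] [NumberField K]

theorem dvd_absNorm_sub_one_of_isPrimitiveRoot (p : HeightOneSpectrum (𝓞 K)) {a : 𝓞 K} {n : ℕ}
    (hn : n ≠ 0) (h : IsPrimitiveRoot (Ideal.Quotient.mk p.asIdeal a) n) :
    n ∣ Ideal.absNorm p.asIdeal - 1 := by
  classical
  have hmax : p.asIdeal.IsMaximal := p.isMaximal
  let : Field (𝓞 K ⧸ p.asIdeal) := Ideal.Quotient.field p.asIdeal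
  have : Finite (𝓞 K ⧸ p.asIdeal) := Ideal.finiteQuotientOfFreeOfNeBot _ p.ne_bot
  let : Fintype (𝓞 K ⧸ p.asIdeal) := Fintype.ofFinite _
  have h2 := FiniteField.pow_card_sub_one_eq_one _ (h.ne_zero hn)
  rw [← Nat.card_eq_fintype_card] at h2
  exact h.dvd_of_pow_eq_one _ h2

/-- With q - 1 = nm, the cofactor of a^n - 1 in a^(nm) - 1 is a geometric sum congruent to m mod p.
It is a unit there, since m ≡ 0 and q ≡ 0 would give 1 ≡ 0. -/
theorem isNonWieferichPlace_of_isPrimitiveRoot (p : HeightOneSpectrum (𝓞 K)) {a : 𝓞 K} {n : ℕ}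
    (hn : n ≠ 0) (h : IsPrimitiveRoot (Ideal.Quotient.mk p.asIdeal a) n)
    (h1 : emultiplicity p.asIdeal (Ideal.span {a ^ n - 1}) = 1) : IsNonWieferichPlace a p := by
  obtain ⟨m, hm⟩ := dvd_absNorm_sub_one_of_isPrimitiveRoot p hn h
  have hq : 1 ≤ Ideal.absNorm p.asIdeal :=
    Nat.one_le_iff_ne_zero.mpr fun h0 => p.ne_bot (Ideal.absNorm_eq_zero_iff.mp h0)
  rw [IsNonWieferichPlace, hm, pow_mul, ← mul_geom_sum, ← Ideal.span_singleton_mul_span_singleton,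
    emultiplicity_mul p.prime, h1, emultiplicity_eq_zero.mpr, add_zero]
  intro hdvd
  rw [Ideal.dvd_span_singleton, ← Ideal.Quotient.eq_zero_iff_mem] at hdvd
  simp only [map_sum, map_pow, h.pow_eq_one, one_pow, Finset.sum_const, Finset.card_range,
    nsmul_eq_mul, mul_one] at hdvd
  have h2 : ((Ideal.absNorm p.asIdeal : ℕ) : 𝓞 K ⧸ p.asIdeal) = 0 := by
    rw [← map_natCast (Ideal.Quotient.mk p.asIdeal)]
    exact Ideal.Quotient.eq_zero_iff_mem.mpr (Ideal.absNorm_mem _)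
  rw [show Ideal.absNorm p.asIdeal = n * m + 1 by omega] at h2
  push_cast at h2
  rw [hdvd, mul_zero, zero_add] at h2
  exact one_ne_zero h2

open scoped Classical in
theorem absNorm_le_or_exists_isNonWieferichPlace {a : 𝓞 K} {n : ℕ} (hn : n ≠ 0)
    (hI : a ^ n - 1 ≠ 0) :
    Ideal.absNorm (Ideal.span {(Polynomial.cyclotomic n (𝓞 K)).eval a}) ≤
        n ^ Module.finrank ℚ K * powerfulNorm (Ideal.span {a ^ n - 1}) ∨
      ∃ p : HeightOneSpectrum (𝓞 K), IsNonWieferichPlace a p ∧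
        IsPrimitiveRoot (Ideal.Quotient.mk p.asIdeal a) n ∧
        Ideal.absNorm p.asIdeal ≤ Ideal.absNorm (Ideal.span {a ^ n - 1}) := by
  rw [or_iff_not_imp_right]
  intro hcon
  have hI' : Ideal.span {a ^ n - 1} ≠ 0 := by simpa using hI
  have hN : Ideal.span {(n : 𝓞 K)} ≠ 0 := by simpa using hn
  have hnorm : Ideal.absNorm (Ideal.span {(n : 𝓞 K)}) = n ^ Module.finrank ℚ K := by
    rw [Ideal.absNorm_span_natCast, RingOfIntegers.rank]
  rw [← hnorm]
  refine absNorm_le_mul_powerfulNorm hI' hN ?_ fun q hq hcount hqJ => ?_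
  · rw [Ideal.dvd_span_singleton, Ideal.mem_span_singleton]
    have := Polynomial.eval_dvd (x := a) (Polynomial.cyclotomic.dvd_X_pow_sub_one n (𝓞 K))
    simpa using this
  · by_contra hqn
    let p : HeightOneSpectrum (𝓞 K) := ⟨q, Ideal.isPrime_of_prime hq, hq.ne_zero⟩
    have : p.asIdeal.IsPrime := p.isPrime
    have hprim : IsPrimitiveRoot (Ideal.Quotient.mk p.asIdeal a) n :=
      isPrimitiveRoot_mk_of_eval_cyclotomic_mem (fun h => hqn (Ideal.dvd_span_singleton.mpr h))
        (Ideal.dvd_span_singleton.mp hqJ)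
    refine hcon ⟨p, isNonWieferichPlace_of_isPrimitiveRoot p hn hprim ?_, hprim, ?_⟩
    · rw [emultiplicity_eq_count_normalizedFactors hq.irreducible hI', normalize_eq, hcount,
        Nat.cast_one]
    · refine Nat.le_of_dvd (Nat.pos_of_ne_zero fun h0 => hI' (Ideal.absNorm_eq_zero_iff.mp h0)) ?_
      refine Ideal.absNorm_dvd_absNorm_of_le (Ideal.dvd_iff_le.mp ?_)
      exact dvd_of_mem_normalizedFactors (Multiset.count_pos.mp (by rw [hcount]; exact one_pos))

theorem exists_forall_mul_lt_pow (C : ℝ) :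
    ∃ f₀ : ℕ, ∀ f : ℕ, f₀ ≤ f → C * f < (3 / 2 : ℝ) ^ f := by
  have h := (tendsto_pow_const_div_const_pow_of_one_lt 1
    (show (1 : ℝ) < 3 / 2 by norm_num)).const_mul C
  rw [mul_zero] at h
  obtain ⟨f₀, hf₀⟩ := Filter.eventually_atTop.mp (h.eventually_lt_const one_pos)
  refine ⟨f₀, fun f hf => ?_⟩
  have h1 := hf₀ f hf
  rwa [pow_one, ← mul_div_assoc, div_lt_one (by positivity)] at h1

theorem ABCConjecture.exists_isNonWieferichPlace (habc : ABCConjecture K) {a : 𝓞 K}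
    (ha : ∀ φ : K →+* ℂ, 2 ≤ ‖φ a‖) {k : ℕ} (hk : 0 < k) :
    ∃ m₀ : ℕ, ∀ m : ℕ, m₀ ≤ m → 0 < m → m ≤ 8 * m.totient →
      ∃ p : HeightOneSpectrum (𝓞 K), IsNonWieferichPlace a p ∧
        IsPrimitiveRoot (Ideal.Quotient.mk p.asIdeal a) (2 * k * m * 2) ∧
        Ideal.absNorm p.asIdeal ≤ Ideal.absNorm (Ideal.span {a ^ (2 * k * m * 2) - 1}) := by
  set d := Module.finrank ℚ K with hd
  have hd0 : 0 < d := Module.finrank_pos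
  set A : ℝ := (Ideal.absNorm (Ideal.span {a}) : ℝ) with hA
  have hA2 : 2 ≤ A := by
    have h1 : (2 : ℝ) ^ d ≤ A := by
      rw [hA, ← Nat.cast_ofNat, ← Nat.cast_pow, Nat.cast_le]
      exact two_pow_finrank_le_absNorm ha
    exact (le_self_pow₀ one_le_two hd0.ne').trans h1
  have hlogA : 0 < Real.log A := Real.log_pos (by linarith)
  have hlog2 : 0 < Real.log 2 := Real.log_pos one_lt_two
  have hk0 : (0 : ℝ) < k := by exact_mod_cast hk
  -- This ε makes A^(2εn) = 2^(m/8) ≤ 2^φ(m) for n = 4km.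
  obtain ⟨C, hC, hQ⟩ := habc.exists_powerfulNorm_le ha
    (ε := Real.log 2 / (64 * k * Real.log A)) (by positivity)
  -- The factor 32k comes from n = 4km ≤ 32kφ(m); max(C, 1) is at most its d-th power, so that d-th
  -- roots can be taken.
  obtain ⟨f₀, hf₀⟩ := exists_forall_mul_lt_pow (max C 1 * (32 * k))
  refine ⟨8 * f₀, fun m hm hm0 hmf => ?_⟩
  have hn : 2 * k * m * 2 ≠ 0 := by positivity
  refine (absNorm_le_or_exists_isNonWieferichPlace hn
    (pow_sub_one_ne_zero_of_two_le ha hn)).resolve_left fun hle => ?_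
  rw [← @Nat.cast_le ℝ] at hle
  have h3 := three_pow_le_absNorm_span_eval_cyclotomic ha (N := 2 * k * m) (by positivity)
    ((dvd_mul_right 2 k).trans (dvd_mul_right _ m))
  rw [← hd] at h3 hle
  set f := m.totient with hf
  have hmf' : (m : ℝ) ≤ 8 * f := by exact_mod_cast hmf
  have hfN : f ≤ (2 * k * m).totient :=
    Nat.le_of_dvd (Nat.totient_pos.mpr (by positivity))
      (Nat.totient_dvd_of_dvd (dvd_mul_left m (2 * k)))
  have hpow : A ^ (2 * (Real.log 2 / (64 * k * Real.log A)) * ((2 * k * m * 2 : ℕ) : ℝ)) ≤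
      (2 ^ f) ^ d := by
    have h1 : A ^ (2 * (Real.log 2 / (64 * k * Real.log A)) * ((2 * k * m * 2 : ℕ) : ℝ)) =
        (2 : ℝ) ^ ((m : ℝ) / 8) := by
      rw [Real.rpow_def_of_pos (by linarith), Real.rpow_def_of_pos two_pos]
      congr 1
      push_cast
      field_simp
      ring
    rw [h1]
    calc (2 : ℝ) ^ ((m : ℝ) / 8) ≤ 2 ^ (f : ℝ) :=
          Real.rpow_le_rpow_of_exponent_le one_le_two (by linarith)
      _ = 2 ^ f := Real.rpow_natCast _ _
      _ ≤ _ := le_self_pow₀ (one_le_pow₀ one_le_two) hd0.ne'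
  have hmain : ((3 : ℝ) ^ f) ^ d ≤ (max C 1 * (32 * k) * f * 2 ^ f) ^ d := by
    calc ((3 : ℝ) ^ f) ^ d = 3 ^ (f * d) := (pow_mul _ _ _).symm
      _ ≤ 3 ^ ((2 * k * m).totient * d) :=
        pow_le_pow_right₀ (by norm_num) (Nat.mul_le_mul_right d hfN)
      _ ≤ _ := h3.trans hle
      _ = ((2 * k * m * 2 : ℕ) : ℝ) ^ d *
          (powerfulNorm (Ideal.span {a ^ (2 * k * m * 2) - 1}) : ℝ) := by
        rw [Nat.cast_mul, Nat.cast_pow]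
      _ ≤ (32 * k * f) ^ d * ((max C 1) ^ d * (2 ^ f) ^ d) := by
        refine mul_le_mul (pow_le_pow_left₀ (by positivity) ?_ d) ((hQ _ hn).trans
          (mul_le_mul ?_ hpow (by positivity) (by positivity))) (by positivity) (by positivity)
        · push_cast
          nlinarith
        · exact (le_max_left C 1).trans (le_self_pow₀ (le_max_right C 1) hd0.ne')
      _ = _ := by
        rw [← mul_pow, ← mul_pow]
        ring
  have h4 := le_of_pow_le_pow_left₀ hd0.ne' (by positivity) hmain
  have h5 := hf₀ f (by omega)
  rw [div_pow, lt_div_iff₀ (by positivity)] at h5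
  linarith

end

/-! ### Counting the places. -/

theorem theorem2 (K : Type*) [Field K] [NumberField K] [IsGalois ℚ K] (habc : ABCConjecture K)
    (k : ℕ) (hk : 0 < k) (i : K →+* ℂ) (a : 𝓞 K)
    (ha : ∀ σ : K ≃ₐ[ℚ] K, 2 ≤ ‖i (σ (a : K))‖) :
    ∃ c : ℝ, 0 < c ∧ ∃ x₀ : ℝ, ∀ x : ℝ, x₀ ≤ x →
      c * Real.log x ≤
        (Set.ncard {p : HeightOneSpectrum (𝓞 K) |
          IsNonWieferichPlace a p ∧ (Ideal.absNorm p.asIdeal : ℝ) ≤ x ∧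
            Ideal.absNorm p.asIdeal ≡ 1 [MOD k]} : ℝ) := by
  have hφ := two_le_norm_embedding i ha
  obtain ⟨m₀, hm₀⟩ := habc.exists_isNonWieferichPlace hφ hk
  set A : ℝ := (Ideal.absNorm (Ideal.span {a}) : ℝ) with hA
  have hAd : (2 : ℝ) ^ Module.finrank ℚ K ≤ A := by
    rw [hA, ← Nat.cast_ofNat, ← Nat.cast_pow, Nat.cast_le]
    exact two_pow_finrank_le_absNorm hφ
  have hA2 : 2 ≤ A :=
    (le_self_pow₀ one_le_two (Module.finrank_pos (R := ℚ) (M := K)).ne').trans hAd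
  have hk0 : (0 : ℝ) < k := by exact_mod_cast hk
  -- Nm(p) ≤ 2^d A^(4km) ≤ A^(8km), which is at most x once m ≤ log x / L.
  set L : ℝ := 8 * k * Real.log A with hL
  have hL0 : 0 < L := mul_pos (by positivity) (Real.log_pos (by linarith))
  -- The count is at least M/8 - m₀ ≥ log x/(8L) - 1/8 - m₀; for x ≥ x₀ the loss is at most half the
  -- main term.
  refine ⟨1 / (16 * L), by positivity, Real.exp (16 * L * (1 / 8 + m₀)), fun x hx => ?_⟩
  have hx0 : 0 < x := (Real.exp_pos _).trans_le hx
  have hlogx : 16 * L * (1 / 8 + m₀) ≤ Real.log x := (Real.le_log_iff_exp_le hx0).mpr hx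
  have hlogx0 : 0 ≤ Real.log x := le_trans (by positivity) hlogx
  set M := ⌊Real.log x / L⌋₊ with hM
  set S := {p : HeightOneSpectrum (𝓞 K) | IsNonWieferichPlace a p ∧
    (Ideal.absNorm p.asIdeal : ℝ) ≤ x ∧ Ideal.absNorm p.asIdeal ≡ 1 [MOD k]} with hS
  have hinj : Function.Injective (HeightOneSpectrum.asIdeal : HeightOneSpectrum (𝓞 K) → _) :=
    fun p q h => HeightOneSpectrum.ext h
  -- Needed because `ncard` of an infinite set is 0.
  have hSfin : S.Finite :=
    ((Ideal.finite_setOfPred_absNorm_le ⌊x⌋₊).preimage hinj.injOn).subset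
      fun p hp => Nat.le_floor hp.2.1
  set G := ((Finset.Icc 1 M).filter fun m => m ≤ 8 * m.totient) \ Finset.range m₀ with hG
  have hex : ∀ m ∈ G, ∃ p ∈ S,
      IsPrimitiveRoot (Ideal.Quotient.mk p.asIdeal a) (2 * k * m * 2) := by
    intro m hm
    simp only [hG, Finset.mem_sdiff, Finset.mem_filter, Finset.mem_Icc, Finset.mem_range,
      not_lt] at hm
    obtain ⟨⟨⟨hm1, hmM⟩, hmf⟩, hmm⟩ := hm
    obtain ⟨p, hp, hprim, hle⟩ := hm₀ m hmm hm1 hmf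
    refine ⟨p, ⟨hp, ?_, ?_⟩, hprim⟩
    · have hn : 1 ≤ 2 * k * m * 2 := Nat.one_le_iff_ne_zero.mpr (by positivity)
      calc (Ideal.absNorm p.asIdeal : ℝ)
          ≤ Ideal.absNorm (Ideal.span {a ^ (2 * k * m * 2) - 1}) := Nat.cast_le.mpr hle
        _ ≤ 2 ^ Module.finrank ℚ K * A ^ (2 * k * m * 2) := absNorm_span_pow_sub_one_le hφ _
        _ ≤ A ^ (2 * k * m * 2) * A ^ (2 * k * m * 2) := by
          gcongr
          exact hAd.trans (le_self_pow₀ (by linarith) (by omega))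
        _ = A ^ (8 * k * m) := by rw [← pow_add]; ring_nf
        _ ≤ A ^ (8 * k * M) := pow_le_pow_right₀ (by linarith) (by gcongr)
        _ ≤ x := by
          rw [← Real.log_le_log_iff (by positivity) hx0, Real.log_pow]
          have h1 := Nat.floor_le (div_nonneg hlogx0 hL0.le)
          rw [← hM, le_div_iff₀ hL0, hL] at h1
          push_cast
          linarith
    · have hq : 1 ≤ Ideal.absNorm p.asIdeal :=
        Nat.one_le_iff_ne_zero.mpr fun h0 => p.ne_bot (Ideal.absNorm_eq_zero_iff.mp h0)
      refine ((Nat.modEq_iff_dvd' hq).mpr ?_).symm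
      exact (Dvd.intro_left (2 * m * 2) (by ring)).trans
        (dvd_absNorm_sub_one_of_isPrimitiveRoot p (by positivity) hprim)
  have hcard : G.card ≤ S.ncard := by
    rw [Set.ncard_eq_toFinset_card S hSfin]
    -- The order of a mod p is 4km, so p determines m.
    refine Finset.card_le_card_of_surjOn
      (fun p => orderOf (Ideal.Quotient.mk p.asIdeal a) / (4 * k)) fun m hm => ?_
    obtain ⟨p, hpS, hp⟩ := hex m hm
    refine ⟨p, hSfin.mem_toFinset.mpr hpS, ?_⟩
    simp only [← hp.eq_orderOf]
    exact Nat.div_eq_of_eq_mul_right (by positivity) (by ring)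
  have hGcard : ((Finset.Icc 1 M).filter fun m => m ≤ 8 * m.totient).card ≤ G.card + m₀ := by
    have := Finset.le_card_sdiff (Finset.range m₀)
      ((Finset.Icc 1 M).filter fun m => m ≤ 8 * m.totient)
    rw [Finset.card_range, ← hG] at this
    omega
  have h1 := le_card_filter_totient M
  have h2 : (((Finset.Icc 1 M).filter fun m => m ≤ 8 * m.totient).card : ℝ) ≤ S.ncard + m₀ := by
    exact_mod_cast hGcard.trans (Nat.add_le_add_right hcard m₀)
  have h3 := (Nat.lt_floor_add_one (Real.log x / L)).le
  rw [← hM] at h3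
  have h4 : 2 * (1 / 8 + (m₀ : ℝ)) ≤ Real.log x / L / 8 := by
    rw [div_div, le_div_iff₀ (by positivity)]
    linarith
  have h5 : 1 / (16 * L) * Real.log x = Real.log x / L / 16 := by
    field_simp
  rw [h5]
  linarith
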